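/- Consider a bipartite Bell scenario in which each party has two inputs and two outputs per run: $x,y,a,b\in\{0,1\}$. For a block of $N$ runs write $\vec a,\vec b,\vec x,\vec y\in\{0,1\}^N$; a point of $\mathcal P_N$ is a probability distribution $P(\vec a\vec b\vec x\vec y)$, with input distribution $P(\vec x\vec y)=\sum_{\vec a,\vec b}P(\vec a\vec b\vec x\vec y)$. The uniform slice is given by $P(\vec x\vec y)=4^{-N}$ for all $\vec x,\vec y$. For $h\ge 0$, let $\mathrm{MDL}_N(h)\subseteq\mathcal P_N$ be the set of points of the form $$P(\vec a\vec b\vec x\vec y)=\int d\lambda\,w(\lambda)\,P(\vec a|\vec x\lambda)\,P(\vec b|\vec y\lambda)\,P(\vec x\vec y|\lambda),\qquad P(\vec x\vec y|\lambda)\le h^N ,$$ where $\lambda$ ranges over an arbitrary probability space with law $w$, and $P(\vec a|\vec x\lambda)$, $P(\vec b|\vec y\lambda)$, $P(\vec x\vec y|\lambda)$ are probability distributions in $\vec a$, in $\vec b$ and in $(\vec x,\vec y)$ that depend measurably on $\lambda$. Conditional distributions $P(ab|xy)$ are no-signalling if $\sum_bP(ab|xy)$ does not depend on $y$ and $\sum_aP(ab|xy)$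 does not depend on $x$. Let $\mathrm{NS}_1\subseteq\mathcal P_1$ be the set of points $P(ab|xy)P(xy)$ with $P(ab|xy)$ no-signalling, and let $\mathrm{NS}_1^{\times 2}\subseteq\mathcal P_2$ be the set of points $$P(\vec a\vec b\vec x\vec y)=\Big(\int d\lambda\,w(\lambda)\prod_{j=1}^2P_{q_j(\lambda)}(a_jb_j|x_jy_j)\Big)P(\vec x\vec y)$$ with every $P_{q_j(\lambda)}(ab|xy)$ no-signalling and measurable in $\lambda$. For $p\in\mathcal P_1$ let $p^{\otimes 2}\in\mathcal P_2$ be its independent repetition, $p^{\otimes2}(\vec a\vec b\vec x\vec y)=\prod_{j=1}^2p(a_jb_jx_jy_j)$. Let $q_{\mathrm{PR}}$ be the Popescu–Rohrlich box with uniform inputs, $P(abxy)=\frac14\cdot\frac12$ if $a\oplus b=xy$ and $0$ otherwise, and let $q_{\mathrm{PR2}}=q_{\mathrm{PR}}^{\otimes2}$. Then: 1. For every $h\ge0$, on the uniform slice $P(\vec x\vec y)=1/16$, $\mathrm{NS}_1^{\times2}\subseteq\mathrm{MDL}_2(h)$ if and only if $h\ge 1/\sqrt{10}$. 2. For every $h\ge0$,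 $q_{\mathrm{PR2}}\in\mathrm{MDL}_2(h)$ if and only if $h\ge1/\sqrt{10}$. 3. Every local deterministic strategy is at least a 6-mismatch strategy with respect to $q_{\mathrm{PR2}}$: for all functions $f,g:\{0,1\}^2\to\{0,1\}^2$, at least $6$ of the $16$ pairs $(\vec x,\vec y)$ satisfy $q_{\mathrm{PR2}}(f(\vec x),g(\vec y),\vec x,\vec y)=0$. 4. For every $h\ge0$, on the uniform slice $P(xy)=1/4$, $\mathrm{NS}_1\subseteq\mathrm{MDL}_1(h)$ if and only if $h\ge1/3$. 5. $\mathrm{MDL}_2$ models are strictly stronger than i.i.d. ones: for every $h\ge0$ and every $p\in\mathrm{MDL}_1(h)$ one has $p^{\otimes2}\in\mathrm{MDL}_2(h)$; and whenever $1/\sqrt{10}\le h<1/3$, there is a $p\in\mathrm{NS}_1$ with $P(xy)=1/4$ such that $p\notin\mathrm{MDL}_1(h)$ but $p^{\otimes2}\in\mathrm{MDL}_2(h)$. -/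

import Mathlib

open MeasureTheory

noncomputable section

namespace MDL

/-- `A`, `B` are the output alphabets and `X`, `Y` the input alphabets of Alice and Bob.
A point assigns to each `(a, b, x, y)` the number `P(abxy)`. -/
abbrev Point (A B X Y : Type) := A × B × X × Y → ℝ

/-- The alphabet of words of length `N` in the letters `A`: one letter for each run of a block. -/
abbrev Word (N : ℕ) (A : Type) := Fin N → A

section

variable {A B X Y : Type} [Fintype A] [Fintype B] [Fintype X] [Fintype Y]

/-- The probability space: all probability distributions `P(abxy)`. -/
def probSpace (A B X Y : Type) [Fintype A] [Fintype B] [Fintype X] [Fintype Y] :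
    Set (Point A B X Y) :=
  stdSimplex ℝ (A × B × X × Y)

/-- The input distribution `P(xy) = ∑_{a,b} P(abxy)`. -/
def inputDist (p : Point A B X Y) (x : X) (y : Y) : ℝ :=
  ∑ a, ∑ b, p (a, b, x, y)

/-- The uniform-measurements slice: `P(xy) = 1 / (|X| |Y|)` for all `x`, `y`. -/
def uniformSlice (A B X Y : Type) [Fintype A] [Fintype B] [Fintype X] [Fintype Y] :
    Set (Point A B X Y) :=
  {p | p ∈ probSpace A B X Y ∧
    ∀ x y, inputDist p x y = 1 / ((Fintype.card X : ℝ) * (Fintype.card Y : ℝ))}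

/-- Measurement-dependent local models with the bound `P(xy|λ) ≤ H`: the points of the form
`P(abxy) = ∫ dλ w(λ) P(a|xλ) P(b|yλ) P(xy|λ)`, where the hidden variable `λ` ranges over an
arbitrary probability space `(Λ, w)`; here `α l x a = P(a|xλ)`, `β l y b = P(b|yλ)` and
`ι l (x, y) = P(xy|λ)`. -/
def mdlSet (A B X Y : Type) [Fintype A] [Fintype B] [Fintype X] [Fintype Y] (H : ℝ) :
    Set (Point A B X Y) :=
  {p | p ∈ probSpace A B X Y ∧
    ∃ (Λ : Type) (_ : MeasurableSpace Λ) (w : Measure Λ) (α : Λ → X → A → ℝ)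
      (β : Λ → Y → B → ℝ) (ι : Λ → X × Y → ℝ),
      IsProbabilityMeasure w ∧
      (∀ x a, Measurable fun l => α l x a) ∧
      (∀ y b, Measurable fun l => β l y b) ∧
      (∀ xy, Measurable fun l => ι l xy) ∧
      (∀ l x, α l x ∈ stdSimplex ℝ A) ∧
      (∀ l y, β l y ∈ stdSimplex ℝ B) ∧
      (∀ l, ι l ∈ stdSimplex ℝ (X × Y)) ∧
      (∀ l xy, ι l xy ≤ H) ∧
      ∀ a b x y, p (a, b, x, y) = ∫ l, α l x a * β l y b * ι l (x, y) ∂w}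

/-- The set `MDL_N` of (dependent-runs) block-`N` models with `P(x⃗y⃗|λ) ≤ h ^ N`. -/
def mdlBlock (A B X Y : Type) [Fintype A] [Fintype B] [Fintype X] [Fintype Y] (N : ℕ) (h : ℝ) :
    Set (Point (Word N A) (Word N B) (Word N X) (Word N Y)) :=
  mdlSet (Word N A) (Word N B) (Word N X) (Word N Y) (h ^ N)

/-- `c x y (a, b) = P(ab|xy)` is a family of conditional probability distributions satisfying the
no-signalling conditions. -/
def IsNoSignalling (c : X → Y → A × B → ℝ) : Prop :=
  (∀ x y, c x y ∈ stdSimplex ℝ (A × B)) ∧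
  (∀ a x y y', ∑ b, c x y (a, b) = ∑ b, c x y' (a, b)) ∧
  (∀ b y x x', ∑ a, c x y (a, b) = ∑ a, c x' y (a, b))

/-- The no-signalling set `NS₁`: points `P(abxy) = P(ab|xy) P(xy)` with no-signalling
conditional distributions `P(ab|xy)`. -/
def nsSet (A B X Y : Type) [Fintype A] [Fintype B] [Fintype X] [Fintype Y] :
    Set (Point A B X Y) :=
  {p | p ∈ probSpace A B X Y ∧ ∃ c : X → Y → A × B → ℝ, IsNoSignalling c ∧
    ∀ a b x y, p (a, b, x, y) = c x y (a, b) * inputDist p x y}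

/-- The product no-signalling set `NS₁^{×N}`: points of the form
`P(a⃗b⃗x⃗y⃗) = (∫ dλ w(λ) ∏_j P_{q_j(λ)}(a_j b_j|x_j y_j)) P(x⃗y⃗)`, each `q_j(λ)` no-signalling,
where `q l j` is the family of conditional distributions of run `j`. -/
def nsProd (A B X Y : Type) [Fintype A] [Fintype B] [Fintype X] [Fintype Y] (N : ℕ) :
    Set (Point (Word N A) (Word N B) (Word N X) (Word N Y)) :=
  {p | p ∈ probSpace (Word N A) (Word N B) (Word N X) (Word N Y) ∧
    ∃ (Λ : Type) (_ : MeasurableSpace Λ) (w : Measure Λ) (q : Λ → Fin N → X → Y → A × B → ℝ),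
      IsProbabilityMeasure w ∧
      (∀ j x y ab, Measurable fun l => q l j x y ab) ∧
      (∀ l j, IsNoSignalling (q l j)) ∧
      ∀ a b x y, p (a, b, x, y) =
        (∫ l, ∏ j, q l j (x j) (y j) (a j, b j) ∂w) * inputDist p x y}

/-- The repetition of a single-run distribution over `N` independent runs. -/
def repetition (N : ℕ) (p : Point A B X Y) :
    Point (Word N A) (Word N B) (Word N X) (Word N Y) :=
  fun t => ∏ j, p (t.1 j, t.2.1 j, t.2.2.1 j, t.2.2.2 j)

/-- The local deterministic strategy with outputs `a = f x`, `b = g y` is a `k`-mismatch strategy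
with respect to `q`, for `k = mismatch q f g`, the number of input pairs `(x, y)` that receive
outputs to which `q` gives probability zero. -/
def mismatch (q : Point A B X Y) (f : X → A) (g : Y → B) : ℕ :=
  {xy : X × Y | q (f xy.1, g xy.2, xy.1, xy.2) = 0}.ncard

end

/-- The Popescu–Rohrlich box with uniform inputs: `P(ab|xy) = 1/2` if `a ⊕ b = x y` and `0`
otherwise, and `P(xy) = 1/4`. Addition in `Fin 2` is addition modulo 2. -/
def prBox : Point (Fin 2) (Fin 2) (Fin 2) (Fin 2) :=
  fun t => (if t.1 + t.2.1 = t.2.2.1 * t.2.2.2 then 1 / 2 else 0) * (1 / 4)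

end MDL

end

/-! Lower bounds. Fix a typical hidden value and choose, for each input, an output of positive
probability. This is a local deterministic strategy, and the hidden input distribution must vanish
wherever the strategy produces an event forbidden by `p`. With at least `k` mismatches, mass 1 sits
on at most `|X||Y| - k` pairs, each of mass at most `H` (`one_le_of_mem_mdlSet`). A strategy matches
the PR box on at most 3 of 4 input pairs and its square on at most 10 of 16, whence `1 ≤ 3h` and `1
≤ 10h²`.

Upper bounds. The PR box is the relation `a + b = xy` over the ring with two elements, and two PR
boxes are the same relation over the product ring. Translations of the inputs, compensated by affine
terms in the outputs, preserve this relation. Averaging a strategy with `m` matches, its inputs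
uniform on the matches, over these symmetries gives the box exactly, with bound `1/m`
(`ringBox_mem_localHull`); `m = 3` and `m = 10` are attained. Every no-signalling point with uniform
inputs is a mixture of deterministic points and boxes (`mem_convexHull_nsVertex`), so the box is the
worst case, also for products by bilinearity. -/

noncomputable section

namespace MDL

/-! ### Products of points and their bilinearity. -/

section ProductPoint

variable {A B X Y : Type}

/-- The product of `N` single-run points. -/
def productPoint {N : ℕ} (p : Fin N → Point A B X Y) :
    Point (Word N A) (Word N B) (Word N X) (Word N Y) :=
  fun t => ∏ j, p j (t.1 j, t.2.1 j, t.2.2.1 j, t.2.2.2 j)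

/-- A word of pairs is a pair of words. -/
def wordProdEquiv (N : ℕ) (X Y : Type) : Word N X × Word N Y ≃ Word N (X × Y) where
  toFun t j := (t.1 j, t.2 j)
  invFun t := (fun j => (t j).1, fun j => (t j).2)

/-- A word of quadruples is a quadruple of words. -/
def wordQuadEquiv (N : ℕ) (A B X Y : Type) :
    Word N A × Word N B × Word N X × Word N Y ≃ Word N (A × B × X × Y) where
  toFun t j := (t.1 j, t.2.1 j, t.2.2.1 j, t.2.2.2 j)
  invFun t := (fun j => (t j).1, fun j => (t j).2.1, fun j => (t j).2.2.1, fun j => (t j).2.2.2)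

theorem isLinearMap_productPoint_left (q : Point A B X Y) :
    IsLinearMap ℝ fun p : Point A B X Y => productPoint ![p, q] := by
  constructor <;> intros <;> ext t <;> simp [productPoint, Fin.prod_univ_two] <;> ring

theorem isLinearMap_productPoint_right (p : Point A B X Y) :
    IsLinearMap ℝ fun q : Point A B X Y => productPoint ![p, q] := by
  constructor <;> intros <;> ext t <;> simp [productPoint, Fin.prod_univ_two] <;> ring

/-- The product is linear in each factor separately, so it is enough to test generators, one factor
at a time. -/
theorem productPoint_mem_of_convexHull {S T : Set (Point A B X Y)}
    {K : Set (Point (Word 2 A) (Word 2 B) (Word 2 X) (Word 2 Y))} (hK : Convex ℝ K)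
    (h : ∀ p ∈ S, ∀ q ∈ T, productPoint ![p, q] ∈ K) {p q : Point A B X Y}
    (hp : p ∈ convexHull ℝ S) (hq : q ∈ convexHull ℝ T) : productPoint ![p, q] ∈ K := by
  have h1 : ∀ p ∈ S, productPoint ![p, q] ∈ K := fun p hpS =>
    convexHull_min (t := (fun q => productPoint ![p, q]) ⁻¹' K) (fun q hqT => h p hpS q hqT)
      (hK.is_linear_preimage (isLinearMap_productPoint_right p)) hq
  exact convexHull_min (t := (fun p => productPoint ![p, q]) ⁻¹' K) h1
    (hK.is_linear_preimage (isLinearMap_productPoint_left q)) hp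

end ProductPoint

/-! ### Local models over arbitrary alphabets: mixtures, the mismatch bound, repetition. -/

section General

variable {A B X Y : Type} [Fintype A] [Fintype B] [Fintype X] [Fintype Y]

/-- The measurement-dependent local points with a constant hidden variable. -/
def localPoints (A B X Y : Type) [Fintype A] [Fintype B] [Fintype X] [Fintype Y] (H : ℝ) :
    Set (Point A B X Y) :=
  {p | ∃ (α : X → A → ℝ) (β : Y → B → ℝ) (ι : X × Y → ℝ),
    (∀ x, α x ∈ stdSimplex ℝ A) ∧ (∀ y, β y ∈ stdSimplex ℝ B) ∧ ι ∈ stdSimplex ℝ (X × Y) ∧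
    (∀ xy, ι xy ≤ H) ∧ ∀ a b x y, p (a, b, x, y) = α x a * β y b * ι (x, y)}

/-- Finite mixtures of measurement-dependent local points. -/
def localHull (A B X Y : Type) [Fintype A] [Fintype B] [Fintype X] [Fintype Y] (H : ℝ) :
    Set (Point A B X Y) :=
  convexHull ℝ (localPoints A B X Y H)

theorem localHull_mono {H H' : ℝ} (h : H ≤ H') :
    localHull A B X Y H ⊆ localHull A B X Y H' := by
  refine convexHull_mono ?_
  rintro p ⟨α, β, ι, hα, hβ, hι, hH, hp⟩
  exact ⟨α, β, ι, hα, hβ, hι, fun xy => (hH xy).trans h, hp⟩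

theorem sum_point (p : Point A B X Y) :
    ∑ t, p t = ∑ x, ∑ y, ∑ a, ∑ b, p (a, b, x, y) := by
  let e : A × B × X × Y ≃ X × Y × A × B :=
    { toFun := fun t => (t.2.2.1, t.2.2.2, t.1, t.2.1)
      invFun := fun t => (t.2.2.1, t.2.2.2, t.1, t.2.1) }
  rw [Fintype.sum_equiv e p (fun t => p (t.2.2.1, t.2.2.2, t.1, t.2.1)) fun _ => rfl]
  simp_rw [Fintype.sum_prod_type]

theorem localPoints_subset_probSpace (H : ℝ) : localPoints A B X Y H ⊆ probSpace A B X Y := by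
  rintro p ⟨α, β, ι, hα, hβ, hι, -, hp⟩
  refine ⟨?_, ?_⟩
  · rintro ⟨a, b, x, y⟩
    rw [hp]
    exact mul_nonneg (mul_nonneg ((hα x).1 a) ((hβ y).1 b)) (hι.1 _)
  · rw [sum_point]
    simp_rw [hp, ← Finset.sum_mul, ← Finset.mul_sum, (hβ _).2, mul_one, (hα _).2, one_mul]
    rw [← hι.2, Fintype.sum_prod_type]

/-- The index of a finite convex combination serves as hidden variable, distributed by a weighted
sum of Dirac measures. All models constructed for the upper bounds on the uniform slice have this
form. -/
theorem localHull_subset_mdlSet (H : ℝ) : localHull A B X Y H ⊆ mdlSet A B X Y H := by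
  intro p hp
  refine ⟨convexHull_min (localPoints_subset_probSpace H) (convex_stdSimplex ℝ _) hp, ?_⟩
  rw [localHull, convexHull_eq] at hp
  obtain ⟨I, t, w, z, hw, hw1, hz, rfl⟩ := hp
  choose α β ι hα hβ hι hH hz using fun i : t => hz i i.2
  refine ⟨t, ⊤, ∑ i : t, ENNReal.ofReal (w i) • @Measure.dirac t ⊤ i, α, β, ι, ?_,
    fun _ _ => measurable_from_top, fun _ _ => measurable_from_top, fun _ => measurable_from_top,
    hα, hβ, hι, hH, ?_⟩
  · let _ : MeasurableSpace t := ⊤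
    constructor
    simp only [Measure.coe_finsetSum, Measure.coe_smul, Finset.sum_apply, Pi.smul_apply,
      measure_univ, smul_eq_mul, mul_one]
    rw [← ENNReal.ofReal_sum_of_nonneg fun (i : t) _ => hw i i.2, Finset.sum_coe_sort t w, hw1,
      ENNReal.ofReal_one]
  · let _ : MeasurableSpace t := ⊤
    intro a b x y
    rw [integral_finsetSum_measure]
    · rw [Finset.centerMass_eq_of_sum_1 _ _ hw1, ← Finset.sum_coe_sort t, Finset.sum_apply]
      refine Finset.sum_congr rfl fun i _ => ?_
      rw [integral_smul_measure, integral_dirac, ENNReal.toReal_ofReal (hw i i.2), Pi.smul_apply,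
        hz i]
    · intro i _
      exact (integrable_dirac enorm_lt_top).smul_measure ENNReal.ofReal_ne_top

theorem le_one_of_mem_stdSimplex {ι : Type} [Fintype ι] {f : ι → ℝ} (hf : f ∈ stdSimplex ℝ ι)
    (i : ι) : f i ≤ 1 :=
  (Finset.single_le_sum (fun j _ => hf.1 j) (Finset.mem_univ i)).trans_eq hf.2

theorem exists_pos_of_mem_stdSimplex {ι : Type} [Fintype ι] {f : ι → ℝ} (hf : f ∈ stdSimplex ℝ ι) :
    ∃ i, 0 < f i := by
  by_contra! h
  have := hf.2
  rw [Finset.sum_eq_zero fun i _ => le_antisymm (h i) (hf.1 i)] at this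
  exact zero_ne_one this

/-- If every local deterministic strategy is a `k`-mismatch strategy with respect to `p`, then the
hidden inputs of a measurement-dependent local model of `p` are supported on `|X| |Y| - k` pairs. -/
theorem one_le_of_mem_mdlSet {H : ℝ} {p : Point A B X Y} (hp : p ∈ mdlSet A B X Y H) {k : ℕ}
    (hk : ∀ f g, k ≤ mismatch p f g) :
    1 ≤ ((Fintype.card X * Fintype.card Y : ℕ) - k : ℝ) * H := by
  classical
  obtain ⟨-, Λ, mΛ, w, α, β, ι, hw, mα, mβ, mι, hα, hβ, hι, hH, hp⟩ := hp
  have key : ∀ᵐ l ∂w, ∀ t : A × B × X × Y, p t = 0 →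
      α l t.2.2.1 t.1 * β l t.2.2.2 t.2.1 * ι l (t.2.2.1, t.2.2.2) = 0 := by
    rw [ae_all_iff]
    rintro ⟨a, b, x, y⟩
    by_cases h0 : p (a, b, x, y) = 0
    · have hnn : ∀ l, 0 ≤ α l x a * β l y b * ι l (x, y) := fun l =>
        mul_nonneg (mul_nonneg ((hα l x).1 a) ((hβ l y).1 b)) ((hι l).1 _)
      have hint : Integrable (fun l => α l x a * β l y b * ι l (x, y)) w := by
        refine Integrable.of_bound (C := 1)
          (((mα x a).mul (mβ y b)).mul (mι _)).aestronglyMeasurable (.of_forall fun l => ?_)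
        rw [Real.norm_of_nonneg (hnn l)]
        exact mul_le_one₀ (mul_le_one₀ (le_one_of_mem_stdSimplex (hα l x) a) ((hβ l y).1 b)
          (le_one_of_mem_stdSimplex (hβ l y) b)) ((hι l).1 _) (le_one_of_mem_stdSimplex (hι l) _)
      rw [hp a b x y, integral_eq_zero_iff_of_nonneg hnn hint] at h0
      filter_upwards [h0] with l hl _ using hl
    · exact .of_forall fun l h => absurd h h0
  -- A single hidden value outside the null sets of the finitely many forbidden events is enough.
  obtain ⟨l, hl⟩ := key.exists
  choose f hf using fun x => exists_pos_of_mem_stdSimplex (hα l x)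
  choose g hg using fun y => exists_pos_of_mem_stdSimplex (hβ l y)
  let S : Finset (X × Y) := Finset.univ.filter fun xy => p (f xy.1, g xy.2, xy.1, xy.2) = 0
  have hS : k ≤ S.card := by
    refine (hk f g).trans_eq ?_
    rw [mismatch, ← Set.ncard_coe_finset]
    simp [S]
  have h0 : ∀ xy ∈ S, ι l xy = 0 := by
    rintro ⟨x, y⟩ hxy
    have := hl (f x, g y, x, y) (Finset.mem_filter.1 hxy).2
    exact (mul_eq_zero.1 this).resolve_left (mul_pos (hf x) (hg y)).ne'
  have hsum : 1 = ∑ xy ∈ Sᶜ, ι l xy := by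
    rw [← (hι l).2, ← Finset.sum_add_sum_compl S, Finset.sum_eq_zero h0, zero_add]
  have hle : 1 ≤ (Sᶜ.card : ℝ) * H := by
    rw [hsum, ← nsmul_eq_mul]
    exact Finset.sum_le_card_nsmul _ _ _ fun xy _ => hH l xy
  have hc : (S.card : ℝ) + Sᶜ.card = (Fintype.card X * Fintype.card Y : ℕ) := by
    rw [← Fintype.card_prod, ← Finset.card_add_card_compl S, Nat.cast_add]
  -- The sign is needed to enlarge the coefficient of `H` from `Sᶜ.card` to `|X||Y| - k`.
  have hH0 : 0 ≤ H := by
    by_contra! hneg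
    exact absurd hle (by nlinarith [Nat.cast_nonneg (α := ℝ) Sᶜ.card])
  have hk' : (k : ℝ) ≤ S.card := by exact_mod_cast hS
  nlinarith

theorem prod_mem_stdSimplex {N : ℕ} {f : Fin N → A → ℝ} (hf : ∀ j, f j ∈ stdSimplex ℝ A) :
    (fun a : Word N A => ∏ j, f j (a j)) ∈ stdSimplex ℝ (Word N A) := by
  classical
  refine ⟨fun a => Finset.prod_nonneg fun j _ => (hf j).1 _, ?_⟩
  have h := Finset.prod_univ_sum (fun _ => Finset.univ) f
  rw [Fintype.piFinset_univ] at h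
  rw [← h]
  exact Finset.prod_eq_one fun j _ => (hf j).2

theorem prod_pair_mem_stdSimplex {N : ℕ} {f : Fin N → X × Y → ℝ}
    (hf : ∀ j, f j ∈ stdSimplex ℝ (X × Y)) :
    (fun t : Word N X × Word N Y => ∏ j, f j (t.1 j, t.2 j)) ∈
      stdSimplex ℝ (Word N X × Word N Y) := by
  refine ⟨fun a => Finset.prod_nonneg fun j _ => (hf j).1 _, ?_⟩
  rw [← (prod_mem_stdSimplex hf).2]
  exact Fintype.sum_equiv (wordProdEquiv N X Y) _ _ fun _ => rfl

theorem productPoint_mem_probSpace {N : ℕ} {p : Fin N → Point A B X Y}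
    (hp : ∀ j, p j ∈ probSpace A B X Y) :
    productPoint p ∈ probSpace (Word N A) (Word N B) (Word N X) (Word N Y) := by
  refine ⟨fun t => Finset.prod_nonneg fun j _ => (hp j).1 _, ?_⟩
  rw [← (prod_mem_stdSimplex hp).2]
  exact Fintype.sum_equiv (wordQuadEquiv N A B X Y) _ _ fun _ => rfl

/-- Independent copies of the hidden variable, one per run, give a product model, and the integral
factors. -/
theorem repetition_mem_mdlBlock {h : ℝ} {p : Point A B X Y} (hp : p ∈ mdlSet A B X Y h) (N : ℕ) :
    repetition N p ∈ mdlBlock A B X Y N h := by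
  obtain ⟨hp0, Λ, mΛ, w, α, β, ι, hw, mα, mβ, mι, hα, hβ, hι, hH, hp⟩ := hp
  refine ⟨productPoint_mem_probSpace fun _ => hp0, Fin N → Λ, inferInstance,
    Measure.pi fun _ => w, fun l x a => ∏ j, α (l j) (x j) (a j),
    fun l y b => ∏ j, β (l j) (y j) (b j), fun l xy => ∏ j, ι (l j) (xy.1 j, xy.2 j),
    inferInstance,
    fun x a => Finset.measurable_fun_prod _ fun j _ => (mα _ _).comp (measurable_pi_apply j),
    fun y b => Finset.measurable_fun_prod _ fun j _ => (mβ _ _).comp (measurable_pi_apply j),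
    fun xy => Finset.measurable_fun_prod _ fun j _ => (mι _).comp (measurable_pi_apply j),
    fun l x => prod_mem_stdSimplex fun j => hα (l j) (x j),
    fun l y => prod_mem_stdSimplex fun j => hβ (l j) (y j),
    fun l => prod_pair_mem_stdSimplex fun j => hι (l j), fun l xy => ?_, fun a b x y => ?_⟩
  · calc ∏ j, ι (l j) (xy.1 j, xy.2 j) ≤ ∏ _j : Fin N, h :=
          Finset.prod_le_prod (fun j _ => (hι _).1 _) fun j _ => hH _ _
      _ = h ^ N := by simp
  · simp_rw [← Finset.prod_mul_distrib]
    rw [integral_fintype_prod_eq_prod (𝕜 := ℝ)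
      (fun j l => α l (x j) (a j) * β l (y j) (b j) * ι l (x j, y j))]
    exact Finset.prod_congr rfl fun j _ => hp _ _ _ _

theorem productPoint_mem_localHull {H H' : ℝ} {p q : Point A B X Y}
    (hp : p ∈ localHull A B X Y H) (hq : q ∈ localHull A B X Y H') :
    productPoint ![p, q] ∈ localHull (Word 2 A) (Word 2 B) (Word 2 X) (Word 2 Y) (H * H') := by
  refine productPoint_mem_of_convexHull (convex_convexHull ℝ _) ?_ hp hq
  rintro p ⟨α, β, ι, hα, hβ, hι, hH, hp⟩ q ⟨α', β', ι', hα', hβ', hι', hH', hq⟩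
  refine subset_convexHull ℝ _ ⟨fun x a => ∏ j, ![α, α'] j (x j) (a j),
    fun y b => ∏ j, ![β, β'] j (y j) (b j), fun t => ∏ j, ![ι, ι'] j (t.1 j, t.2 j),
    fun x => prod_mem_stdSimplex fun j => ?_, fun y => prod_mem_stdSimplex fun j => ?_,
    prod_pair_mem_stdSimplex fun j => ?_, fun xy => ?_, fun a b x y => ?_⟩
  · fin_cases j <;> simp [hα, hα']
  · fin_cases j <;> simp [hβ, hβ']
  · fin_cases j <;> simp [hι, hι']
  · have h0 := (hι.1 (xy.1 0, xy.2 0)).trans (hH _)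
    simpa [Fin.prod_univ_two] using mul_le_mul (hH _) (hH' _) (hι'.1 _) h0
  · simp [productPoint, Fin.prod_univ_two, hp, hq]
    ring

end General

/-! ### Boxes over finite commutative rings. -/

section RingBox

variable {R : Type} [CommRing R] [Fintype R] [DecidableEq R]

/-- The analogue of the Popescu–Rohrlich box over a finite commutative ring `R`, with uniform
inputs and up to relabelling: `a + b = (x + β) (y + α) + γ`. -/
def ringBox (β α γ : R) : Point R R R R :=
  fun t => if t.1 + t.2.1 = (t.2.2.1 + β) * (t.2.2.2 + α) + γ
    then 1 / (Fintype.card R : ℝ) ^ 3 else 0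

/-- The inputs on which the local deterministic strategy `f`, `g` satisfies `a + b = x y`. -/
def matchSet (f g : R → R) : Finset (R × R) :=
  Finset.univ.filter fun xy => f xy.1 + g xy.2 = xy.1 * xy.2

theorem ite_eq_mem_stdSimplex {A : Type} [Fintype A] [DecidableEq A] (c : A) :
    (fun a => if a = c then (1 : ℝ) else 0) ∈ stdSimplex ℝ A :=
  ⟨fun a => by positivity, by simp⟩

/-- A local deterministic strategy with `m` matches yields the box as a mixture of its translates
under the symmetries of the equation `a + b = x y`. -/
theorem ringBox_mem_localHull (f g : R → R) (hm : (matchSet f g).Nonempty) (β α γ : R) :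
    ringBox β α γ ∈ localHull R R R R (1 / (matchSet f g).card) := by
  set m : ℝ := ((matchSet f g).card : ℝ) with hm_def
  have hm0 : 0 < m := by simpa [hm_def] using hm
  let κ : R × R → ℝ := fun xy => if xy ∈ matchSet f g then 1 / m else 0
  have hκ0 : ∀ xy, 0 ≤ κ xy := fun xy => by dsimp only [κ]; positivity
  have hκ1 : ∀ xy, κ xy ≤ 1 / m := fun xy => by
    dsimp only [κ]
    split_ifs
    · exact le_rfl
    · positivity
  have hκs : ∑ xy, κ xy = 1 := by
    simp only [κ, Finset.sum_ite_mem, Finset.univ_inter, Finset.sum_const, nsmul_eq_mul]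
    rw [← hm_def, mul_one_div_cancel hm0.ne']
  -- With `l = (s, t, u)`, the outputs come from `(x₀ + s)(y₀ + t) = x₀y₀ + t x₀ + s y₀ + st`: Alice
  -- adds `t x₀ + st`, Bob adds `s y₀`. The shared shift `u` cancels in the sum and makes each
  -- output uniform.
  let x₀ : R × R × R → R → R := fun l x => x + β - l.1
  let y₀ : R × R × R → R → R := fun l y => y + α - l.2.1
  let F : R × R × R → R → R := fun l x => f (x₀ l x) + l.2.1 * x₀ l x + l.1 * l.2.1 + l.2.2
  let G : R × R × R → R → R := fun l y => g (y₀ l y) + l.1 * y₀ l y - l.2.2 + γ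
  let D : R × R × R → Point R R R R := fun l t =>
    (if t.1 = F l t.2.2.1 then 1 else 0) * (if t.2.1 = G l t.2.2.2 then 1 else 0) *
      κ (x₀ l t.2.2.1, y₀ l t.2.2.2)
  have hD : ∀ l, D l ∈ localPoints R R R R (1 / m) := fun l => by
    refine ⟨fun x a => if a = F l x then 1 else 0, fun y b => if b = G l y then 1 else 0,
      fun xy => κ (x₀ l xy.1, y₀ l xy.2), fun x => ite_eq_mem_stdSimplex _,
      fun y => ite_eq_mem_stdSimplex _, ⟨fun _ => hκ0 _, ?_⟩, fun _ => hκ1 _,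
      fun a b x y => rfl⟩
    rw [← hκs]
    refine Fintype.sum_equiv (Equiv.addRight (β - l.1, α - l.2.1)) _ _ fun xy => ?_
    simp only [x₀, y₀, add_sub_assoc]
    rfl
  have hc0 : (Fintype.card R : ℝ) ≠ 0 := by
    simp
  have hsum : ringBox β α γ = ∑ l, (1 / (Fintype.card R : ℝ) ^ 3) • D l := by
    ext ⟨a, b, x, y⟩
    rw [Finset.sum_apply]
    simp only [Pi.smul_apply, smul_eq_mul, ← Finset.mul_sum]
    -- For fixed `s`, `t` exactly one `u` produces the output `a`. Since `κ` vanishes off the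
    -- matches, Bob's output is then `b` exactly when the box relation holds.
    have hu : ∀ s t, ∑ u, D (s, t, u) (a, b, x, y) =
        (if a + b = (x + β) * (y + α) + γ then 1 else 0) * κ (x + β - s, y + α - t) := by
      intro s t
      by_cases hxy : (x + β - s, y + α - t) ∈ matchSet f g
      · have hxy' : f (x + β - s) + g (y + α - t) = (x + β - s) * (y + α - t) := by
          simpa [matchSet] using hxy
        simp only [D, ← Finset.sum_mul, x₀, y₀]
        congr 1
        simp only [F, G, x₀, y₀]
        rw [Finset.sum_eq_single
          (a - (f (x + β - s) + t * (x + β - s) + s * t)) ?_ (by simp)]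
        · rw [if_pos (by ring), one_mul]
          refine if_congr ?_ rfl rfl
          exact ⟨fun h => by linear_combination h + hxy', fun h => by linear_combination h - hxy'⟩
        · intro u _ hu
          rw [if_neg, zero_mul]
          rintro rfl
          exact hu (by ring)
      · simp [D, κ, x₀, y₀, hxy]
    simp_rw [Fintype.sum_prod_type, hu, ← Finset.mul_sum]
    -- At fixed inputs the translations sweep out every pair once, so the averaged inputs are
    -- uniform.
    have hshift : ∑ s, ∑ t, κ (x + β - s, y + α - t) = 1 := by
      rw [← hκs, ← Fintype.sum_prod_type' fun s t => κ (x + β - s, y + α - t)]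
      exact Fintype.sum_equiv (Equiv.subLeft (x + β, y + α)) _ _ fun _ => rfl
    rw [hshift]
    simp [ringBox]
  rw [hsum]
  refine (convex_convexHull ℝ _).sum_mem (fun _ _ => by positivity) ?_
    fun l _ => subset_convexHull ℝ _ (hD l)
  simp only [Finset.sum_const, Finset.card_univ, Fintype.card_prod, nsmul_eq_mul, Nat.cast_mul]
  field_simp

end RingBox

/-! ### Generating a cone by vectors of small support. -/

/-- If every nonzero nonnegative vector of a subspace dominates the support of some member of a
finite family of nonzero nonnegative vectors of the subspace, then this family generates the cone
of nonnegative vectors. -/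
theorem exists_nonneg_combination {T I : Type} [Fintype T] [Fintype I] (M : Submodule ℝ (T → ℝ))
    (v : I → T → ℝ) (hvM : ∀ i, v i ∈ M) (hv0 : ∀ i, 0 ≤ v i) (hne : ∀ i, v i ≠ 0)
    (hsupp : ∀ p ∈ M, 0 ≤ p → p ≠ 0 → ∃ i, ∀ t, p t = 0 → v i t = 0)
    (p : T → ℝ) (hp : p ∈ M) (hp0 : 0 ≤ p) :
    ∃ w : I → ℝ, 0 ≤ w ∧ p = ∑ i, w i • v i := by
  classical
  induction hn : (Finset.univ.filter fun t => p t ≠ 0).card using Nat.strong_induction_on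
    generalizing p with
  | _ n ih =>
    by_cases h0 : p = 0
    · exact ⟨0, le_rfl, by simp [h0]⟩
    obtain ⟨i, hi⟩ := hsupp p hp hp0 h0
    have hpos : (Finset.univ.filter fun t => 0 < v i t).Nonempty := by
      obtain ⟨t, ht⟩ := Function.ne_iff.1 (hne i)
      exact ⟨t, Finset.mem_filter.2 ⟨Finset.mem_univ _, lt_of_le_of_ne (hv0 i t) (Ne.symm ht)⟩⟩
    -- The minimal ratio is the largest multiple of `v i` that can be subtracted from `p` without
    -- losing positivity; it kills the coordinate `t₀`, so the support shrinks.
    obtain ⟨t₀, ht₀, hmin⟩ := Finset.exists_min_image _ (fun t => p t / v i t) hpos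
    have ht₀ : 0 < v i t₀ := (Finset.mem_filter.1 ht₀).2
    have hr0 : 0 ≤ p t₀ / v i t₀ := div_nonneg (hp0 _) ht₀.le
    set r := p t₀ / v i t₀ with hr
    have hq0 : 0 ≤ p - r • v i := by
      intro t
      simp only [Pi.zero_apply, Pi.sub_apply, Pi.smul_apply, smul_eq_mul, sub_nonneg]
      rcases (hv0 i t).eq_or_lt with h | h
      · rw [← h]
        simpa using hp0 t
      · exact (le_div_iff₀ h).1 (hmin t (by simpa using h))
    have hq : p - r • v i ∈ M := M.sub_mem hp (M.smul_mem _ (hvM i))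
    have hcard : (Finset.univ.filter fun t => (p - r • v i) t ≠ 0).card < n := by
      rw [← hn]
      refine Finset.card_lt_card (Finset.ssubset_iff_subset_ne.2 ⟨fun t ht => ?_, fun heq => ?_⟩)
      · simp only [Finset.mem_filter, Finset.mem_univ, true_and] at ht ⊢
        contrapose! ht
        simp [ht, hi t ht]
      · have : t₀ ∈ Finset.univ.filter fun t => p t ≠ 0 := by
          simpa using fun h => ht₀.ne' (hi t₀ h)
        rw [← heq] at this
        simp [hr, ht₀.ne'] at this
    obtain ⟨w, hw0, hw⟩ := ih _ hcard _ hq hq0 rfl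
    refine ⟨w + Pi.single i r, add_nonneg hw0 (Pi.single_nonneg.2 hr0), ?_⟩
    simp only [Pi.add_apply, add_smul, Finset.sum_add_distrib, ← hw, Pi.single_apply, ite_smul,
      zero_smul, Finset.sum_ite_eq', Finset.mem_univ, if_true]
    abel

/-! ### Vertices of the binary no-signalling polytope. -/

section Binary

open scoped Fin.CommRing

/-- The points satisfying the no-signalling conditions, without positivity and normalization. -/
def nsSubspace : Submodule ℝ (Point (Fin 2) (Fin 2) (Fin 2) (Fin 2)) where
  carrier := {p | (∀ a x y y', ∑ b, p (a, b, x, y) = ∑ b, p (a, b, x, y')) ∧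
    ∀ b y x x', ∑ a, p (a, b, x, y) = ∑ a, p (a, b, x', y)}
  zero_mem' := by simp
  add_mem' := by
    rintro p q ⟨hp, hp'⟩ ⟨hq, hq'⟩
    refine ⟨fun a x y y' => ?_, fun b y x x' => ?_⟩
    · simp only [Pi.add_apply, Finset.sum_add_distrib, hp a x y y', hq a x y y']
    · simp only [Pi.add_apply, Finset.sum_add_distrib, hp' b y x x', hq' b y x x']
  smul_mem' := by
    rintro r p ⟨hp, hp'⟩
    refine ⟨fun a x y y' => ?_, fun b y x x' => ?_⟩
    · simp only [Pi.smul_apply, ← Finset.smul_sum, hp a x y y']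
    · simp only [Pi.smul_apply, ← Finset.smul_sum, hp' b y x x']

/-- The local deterministic point with uniform inputs. -/
def detPoint (f g : Fin 2 → Fin 2) : Point (Fin 2) (Fin 2) (Fin 2) (Fin 2) :=
  fun t => if t.1 = f t.2.2.1 ∧ t.2.1 = g t.2.2.2 then 1 / 4 else 0

/-- The vertices of the no-signalling polytope: local deterministic points and boxes. -/
def nsVertex : (Fin 2 → Fin 2) × (Fin 2 → Fin 2) ⊕ Fin 2 × Fin 2 × Fin 2 →
    Point (Fin 2) (Fin 2) (Fin 2) (Fin 2)
  | .inl v => detPoint v.1 v.2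
  | .inr v => ringBox v.1 v.2.1 v.2.2

theorem nsVertex_nonneg (v) : 0 ≤ nsVertex v := by
  intro t
  rcases v with v | v
  · simp only [nsVertex, detPoint, Pi.zero_apply]
    positivity
  · simp only [nsVertex, ringBox, Pi.zero_apply]
    positivity

theorem nsVertex_mem_nsSubspace (v) : nsVertex v ∈ nsSubspace := by
  rcases v with ⟨f, g⟩ | ⟨β, α, γ⟩
  · refine ⟨fun a x y y' => ?_, fun b y x x' => ?_⟩
    · simp [nsVertex, detPoint, ite_and]
    · simp only [nsVertex, detPoint, and_comm (b := b = g y)]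
      simp [ite_and]
  · refine ⟨fun a x y y' => ?_, fun b y x x' => ?_⟩
    · simp [nsVertex, ringBox, ← eq_sub_iff_add_eq']
    · simp [nsVertex, ringBox, ← eq_sub_iff_add_eq]

theorem sum_nsVertex (v) : ∑ t, nsVertex v t = 1 := by
  rcases v with ⟨f, g⟩ | ⟨β, α, γ⟩
  · rw [sum_point]
    simp only [nsVertex, detPoint, ite_and]
    simp
    norm_num
  · rw [sum_point]
    simp only [nsVertex, ringBox, ← eq_sub_iff_add_eq']
    simp
    norm_num

/-- A function of two bits is a polynomial over the two-element field; the alternatives are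
coefficient 0 or 1 of `xy`. -/
theorem exists_correlation (k : Fin 2 → Fin 2 → Fin 2) :
    (∃ f g : Fin 2 → Fin 2, ∀ x y, f x + g y = k x y) ∨
      ∃ β α γ : Fin 2, ∀ x y, k x y = (x + β) * (y + α) + γ := by
  revert k
  decide

/-- A nonempty no-signalling possibility table contains a local deterministic one or a box. -/
theorem exists_subtable (S : Fin 2 → Fin 2 → Fin 2 → Fin 2 → Prop)
    (hA : ∀ x y y' a b, S x y a b → ∃ b', S x y' a b')
    (hB : ∀ x x' y a b, S x y a b → ∃ a', S x' y a' b)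
    (hS : ∃ x y a b, S x y a b) :
    (∃ f g : Fin 2 → Fin 2, ∀ x y, S x y (f x) (g y)) ∨
      ∃ β α γ : Fin 2, ∀ x y a b, a + b = (x + β) * (y + α) + γ → S x y a b := by
  by_cases hN : ∃ f g : Fin 2 → Fin 2, ∀ x y, S x y (f x) (g y)
  · exact .inl hN
  refine .inr ?_
  have hflip : ∀ u v : Fin 2, u = v ∨ u = v + 1 := by decide
  -- Outputs that fit together around the cycle of four input pairs would form a deterministic
  -- strategy.
  have hcyc : ∀ x y a b a' b', S x y a b → S x (y + 1) a b' → S (x + 1) (y + 1) a' b' →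
      ¬ S (x + 1) y a' b := by
    intro x y a b a' b' h1 h2 h3 h4
    refine hN ⟨fun z => if z = x then a else a', fun z => if z = y then b else b', fun z z' => ?_⟩
    have hne : ∀ u : Fin 2, u + 1 ≠ u := by decide
    rcases hflip z x with rfl | rfl <;> rcases hflip z' y with rfl | rfl <;> simpa [hne]
  -- No-signalling lets the walk around the cycle continue; as it cannot close up, it returns to
  -- input `y` with `b` flipped.
  have hwalk : ∀ x y a b, S x y a b → ∃ a', S (x + 1) y a' (b + 1) ∧
      ∃ b', S x (y + 1) a b' ∧ S (x + 1) (y + 1) a' b' := by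
    intro x y a b h
    obtain ⟨b', h2⟩ := hA x y (y + 1) a b h
    obtain ⟨a', h3⟩ := hB x (x + 1) (y + 1) a b' h2
    obtain ⟨b'', h4⟩ := hA (x + 1) (y + 1) y a' b' h3
    rcases hflip b'' b with rfl | rfl
    · exact absurd h4 (hcyc _ _ _ _ _ _ h h2 h3)
    · exact ⟨a', h4, b', h2, h3⟩
  -- The walk from `(a, b)` would close up from `(a, b + 1)`. Together with `hBu` this makes the
  -- possible outputs at each input pair a class `a + b = const`.
  have hAu : ∀ x y a b, S x y a b → ¬ S x y a (b + 1) := by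
    intro x y a b h h'
    obtain ⟨a', h4, b', h2, h3⟩ := hwalk x y a b h
    exact hcyc _ _ _ _ _ _ h' h2 h3 h4
  have hBu : ∀ x y a b, S x y a b → S x y (a + 1) (b + 1) := by
    intro x y a b h
    obtain ⟨a', h4, -⟩ := hwalk x y a b h
    obtain ⟨a'', h5⟩ := hB _ x _ _ _ h4
    rcases hflip a'' a with rfl | rfl
    · exact absurd h5 (hAu _ _ _ _ h)
    · exact h5
  have hall : ∀ x y, ∃ a b, S x y a b := by
    obtain ⟨x₀, y₀, a, b, h⟩ := hS
    intro x y
    obtain ⟨b', h'⟩ := hA x₀ y₀ y a b h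
    obtain ⟨a', h''⟩ := hB x₀ x y a b' h'
    exact ⟨a', b', h''⟩
  choose a b hab using hall
  have hk : ∀ x y c d, c + d = a x y + b x y → S x y c d := by
    intro x y c d hcd
    rcases hflip c (a x y) with rfl | rfl
    · rw [add_left_cancel hcd]
      exact hab x y
    · have hd : d = b x y + 1 := by
        revert hcd
        generalize a x y = u
        generalize b x y = v
        revert u v d
        decide
      rw [hd]
      exact hBu _ _ _ _ (hab x y)
  rcases exists_correlation fun x y => a x y + b x y with ⟨f, g, h⟩ | ⟨β, α, γ, h⟩
  · exact absurd ⟨f, g, fun x y => hk x y _ _ (h x y)⟩ hN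
  · exact ⟨β, α, γ, fun x y c d hcd => hk x y c d (hcd.trans (h x y).symm)⟩

/-- By positivity, equal marginals force the support of `p` to be a no-signalling possibility table,
to which `exists_subtable` applies. -/
theorem exists_nsVertex_support (p : Point (Fin 2) (Fin 2) (Fin 2) (Fin 2)) (hp : p ∈ nsSubspace)
    (hp0 : 0 ≤ p) (hne : p ≠ 0) : ∃ v, ∀ t, p t = 0 → nsVertex v t = 0 := by
  obtain ⟨hA, hB⟩ := hp
  have hS := exists_subtable (fun x y a b => p (a, b, x, y) ≠ 0) ?_ ?_ ?_
  · rcases hS with ⟨f, g, h⟩ | ⟨β, α, γ, h⟩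
    · refine ⟨.inl (f, g), ?_⟩
      rintro ⟨a, b, x, y⟩ ht
      refine if_neg ?_
      rintro ⟨ha, hb⟩
      dsimp only at ha hb
      subst ha hb
      exact h x y ht
    · refine ⟨.inr (β, α, γ), ?_⟩
      rintro ⟨a, b, x, y⟩ ht
      exact if_neg fun hab => h x y a b hab ht
  · intro x y y' a b h
    by_contra! h'
    have := hA a x y y'
    rw [Finset.sum_eq_zero fun b' _ => h' b'] at this
    exact h ((Finset.sum_eq_zero_iff_of_nonneg fun b _ => hp0 (a, b, x, y)).1 this b
      (Finset.mem_univ _))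
  · intro x x' y a b h
    by_contra! h'
    have := hB b y x x'
    rw [Finset.sum_eq_zero fun a' _ => h' a'] at this
    exact h ((Finset.sum_eq_zero_iff_of_nonneg fun a _ => hp0 (a, b, x, y)).1 this a
      (Finset.mem_univ _))
  · obtain ⟨⟨a, b, x, y⟩, h⟩ := Function.ne_iff.1 hne
    exact ⟨x, y, a, b, h⟩

theorem mem_convexHull_nsVertex {p : Point (Fin 2) (Fin 2) (Fin 2) (Fin 2)} (hp : p ∈ nsSubspace)
    (hp1 : p ∈ probSpace (Fin 2) (Fin 2) (Fin 2) (Fin 2)) :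
    p ∈ convexHull ℝ (Set.range nsVertex) := by
  obtain ⟨w, hw0, rfl⟩ := exists_nonneg_combination nsSubspace nsVertex nsVertex_mem_nsSubspace
    nsVertex_nonneg (fun v h => by simpa [h] using sum_nsVertex v) exists_nsVertex_support p hp
    hp1.1
  refine (convex_convexHull ℝ _).sum_mem (fun v _ => hw0 v) ?_
    fun v _ => subset_convexHull ℝ _ ⟨v, rfl⟩
  have := hp1.2
  simp only [Finset.sum_apply, Pi.smul_apply] at this
  rw [Finset.sum_comm] at this
  rw [← this]
  exact Finset.sum_congr rfl fun v _ => by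
    rw [← Finset.smul_sum, sum_nsVertex, smul_eq_mul, mul_one]

/-- A no-signalling family of conditional distributions, taken with uniform inputs. -/
theorem uniform_mem_convexHull_nsVertex {c : Fin 2 → Fin 2 → Fin 2 × Fin 2 → ℝ}
    (hc : IsNoSignalling c) :
    (fun t => c t.2.2.1 t.2.2.2 (t.1, t.2.1) * (1 / 4) : Point _ _ _ _) ∈
      convexHull ℝ (Set.range nsVertex) := by
  obtain ⟨h1, hA, hB⟩ := hc
  refine mem_convexHull_nsVertex ⟨fun a x y y' => ?_, fun b y x x' => ?_⟩ ⟨fun t => ?_, ?_⟩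
  · simp only [← Finset.sum_mul, hA a x y y']
  · simp only [← Finset.sum_mul, hB b y x x']
  · exact mul_nonneg ((h1 _ _).1 _) (by norm_num)
  · rw [sum_point]
    simp only [← Finset.sum_mul, ← Fintype.sum_prod_type' fun a b => c _ _ (a, b), (h1 _ _).2]
    norm_num

/-! ### Optimal models for boxes and for no-signalling points. -/

theorem prBox_eq_ringBox : prBox = ringBox 0 0 0 := by
  ext t
  simp only [prBox, ringBox, add_zero, Fintype.card_fin]
  split_ifs <;> norm_num

theorem productPoint_ringBox (β α γ β' α' γ' : Fin 2) :
    productPoint ![ringBox β α γ, ringBox β' α' γ'] =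
      ringBox (R := Word 2 (Fin 2)) ![β, β'] ![α, α'] ![γ, γ'] := by
  ext t
  simp only [productPoint, ringBox, Fin.prod_univ_two, funext_iff, Fin.forall_fin_two,
    Matrix.cons_val_zero, Matrix.cons_val_one, Pi.add_apply, Pi.mul_apply, Fintype.card_fin,
    Fintype.card_pi, ite_and]
  split_ifs <;> norm_num

theorem repetition_prBox : repetition 2 prBox = ringBox (R := Word 2 (Fin 2)) 0 0 0 := by
  have h : repetition 2 prBox = productPoint ![prBox, prBox] := by
    ext t
    simp [repetition, productPoint, Fin.prod_univ_two]
  rw [h, prBox_eq_ringBox, productPoint_ringBox]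
  congr 1 <;> ext i <;> fin_cases i <;> rfl

theorem ringBox_two_mem_localHull (β α γ : Fin 2) :
    ringBox β α γ ∈ localHull (Fin 2) (Fin 2) (Fin 2) (Fin 2) (1 / 3) := by
  have hc : (matchSet (0 : Fin 2 → Fin 2) 0).card = 3 := by decide
  have := ringBox_mem_localHull (0 : Fin 2 → Fin 2) 0 (Finset.card_pos.1 (by omega)) β α γ
  rwa [hc] at this

theorem ringBox_word_mem_localHull (β α γ : Word 2 (Fin 2)) :
    ringBox β α γ ∈ localHull (Word 2 (Fin 2)) (Word 2 (Fin 2)) (Word 2 (Fin 2)) (Word 2 (Fin 2))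
      (1 / 10) := by
  -- The matching conditions read `y₀(x₀ + y₁) = 0` and `x₁(x₀ + y₁) = 0`: 8 pairs with `x₀ = y₁`,
  -- and 2 more with `x₁ = y₀ = 0`.
  let f : Word 2 (Fin 2) → Word 2 (Fin 2) := fun x => ![0, x 0 * x 1]
  let g : Word 2 (Fin 2) → Word 2 (Fin 2) := fun y => ![y 0 * y 1, 0]
  have hc : (matchSet f g).card = 10 := by decide +kernel
  have := ringBox_mem_localHull f g (Finset.card_pos.1 (by omega)) β α γ
  rwa [hc] at this

theorem detPoint_mem_localHull (f g : Fin 2 → Fin 2) :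
    detPoint f g ∈ localHull (Fin 2) (Fin 2) (Fin 2) (Fin 2) (1 / 4) := by
  refine subset_convexHull ℝ _ ⟨fun x a => if a = f x then 1 else 0,
    fun y b => if b = g y then 1 else 0, fun _ => 1 / 4, fun x => ite_eq_mem_stdSimplex _,
    fun y => ite_eq_mem_stdSimplex _, ⟨fun _ => by norm_num, by simp⟩, fun _ => le_rfl,
    fun a b x y => ?_⟩
  simp only [detPoint, ite_and]
  split_ifs <;> simp

theorem nsVertex_mem_localHull (v) :
    nsVertex v ∈ localHull (Fin 2) (Fin 2) (Fin 2) (Fin 2) (1 / 3) := by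
  rcases v with v | v
  · exact localHull_mono (by norm_num) (detPoint_mem_localHull _ _)
  · exact ringBox_two_mem_localHull _ _ _

/-- A deterministic factor leaves room for independent models, `1/4 · 1/3 < 1/10`. For two boxes
these give only `1/9`, so the joint model over the product ring is needed. -/
theorem productPoint_nsVertex_mem_localHull (v v') :
    productPoint ![nsVertex v, nsVertex v'] ∈
      localHull (Word 2 (Fin 2)) (Word 2 (Fin 2)) (Word 2 (Fin 2)) (Word 2 (Fin 2)) (1 / 10) := by
  rcases v with v | v
  · exact localHull_mono (by norm_num)
      (productPoint_mem_localHull (detPoint_mem_localHull v.1 v.2) (nsVertex_mem_localHull v'))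
  · rcases v' with v' | v'
    · exact localHull_mono (by norm_num) (productPoint_mem_localHull
        (ringBox_two_mem_localHull v.1 v.2.1 v.2.2) (detPoint_mem_localHull v'.1 v'.2))
    · simp only [nsVertex]
      rw [productPoint_ringBox]
      exact ringBox_word_mem_localHull _ _ _

theorem nsSet_uniform_subset_localHull :
    nsSet (Fin 2) (Fin 2) (Fin 2) (Fin 2) ∩ uniformSlice (Fin 2) (Fin 2) (Fin 2) (Fin 2) ⊆
      localHull (Fin 2) (Fin 2) (Fin 2) (Fin 2) (1 / 3) := by
  rintro p ⟨⟨-, c, hc, hp⟩, -, hu⟩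
  have h : p = fun t => c t.2.2.1 t.2.2.2 (t.1, t.2.1) * (1 / 4) := by
    ext ⟨a, b, x, y⟩
    rw [hp, hu]
    norm_num
  rw [h]
  exact convexHull_min (Set.range_subset_iff.2 nsVertex_mem_localHull) (convex_convexHull ℝ _)
    (uniform_mem_convexHull_nsVertex hc)

theorem nsProd_uniform_subset_localHull :
    nsProd (Fin 2) (Fin 2) (Fin 2) (Fin 2) 2 ∩
        uniformSlice (Word 2 (Fin 2)) (Word 2 (Fin 2)) (Word 2 (Fin 2)) (Word 2 (Fin 2)) ⊆
      localHull (Word 2 (Fin 2)) (Word 2 (Fin 2)) (Word 2 (Fin 2)) (Word 2 (Fin 2)) (1 / 10) := by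
  rintro p ⟨⟨-, Λ, mΛ, w, q, hw, mq, hq, hp⟩, -, hu⟩
  let V : Set (Point (Word 2 (Fin 2)) (Word 2 (Fin 2)) (Word 2 (Fin 2)) (Word 2 (Fin 2))) :=
    Set.range fun v : _ × _ => productPoint ![nsVertex v.1, nsVertex v.2]
  let F : Λ → Point (Word 2 (Fin 2)) (Word 2 (Fin 2)) (Word 2 (Fin 2)) (Word 2 (Fin 2)) :=
    fun l t => (∏ j, q l j (t.2.2.1 j) (t.2.2.2 j) (t.1 j, t.2.1 j)) * (1 / 16)
  have hF : ∀ l, F l ∈ convexHull ℝ V := by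
    intro l
    have h : F l = productPoint
        ![fun t => q l 0 t.2.2.1 t.2.2.2 (t.1, t.2.1) * (1 / 4),
          fun t => q l 1 t.2.2.1 t.2.2.2 (t.1, t.2.1) * (1 / 4)] := by
      ext t
      simp only [F, productPoint, Fin.prod_univ_two, Matrix.cons_val_zero, Matrix.cons_val_one]
      ring
    rw [h]
    refine productPoint_mem_of_convexHull (convex_convexHull ℝ _) ?_
      (uniform_mem_convexHull_nsVertex (hq l 0)) (uniform_mem_convexHull_nsVertex (hq l 1))
    rintro _ ⟨v, rfl⟩ _ ⟨v', rfl⟩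
    exact subset_convexHull ℝ _ ⟨(v, v'), rfl⟩
  have hint : ∀ t, Integrable (fun l => F l t) w := by
    intro t
    refine Integrable.of_bound (C := 1 / 16) ((Finset.measurable_fun_prod _ fun j _ =>
      mq j _ _ _).mul_const _).aestronglyMeasurable (.of_forall fun l => ?_)
    have h0 : 0 ≤ ∏ j, q l j (t.2.2.1 j) (t.2.2.2 j) (t.1 j, t.2.1 j) :=
      Finset.prod_nonneg fun j _ => ((hq l j).1 _ _).1 _
    have h1 : ∏ j, q l j (t.2.2.1 j) (t.2.2.2 j) (t.1 j, t.2.1 j) ≤ 1 :=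
      Finset.prod_le_one (fun j _ => ((hq l j).1 _ _).1 _)
        fun j _ => le_one_of_mem_stdSimplex ((hq l j).1 _ _) _
    rw [Real.norm_of_nonneg (mul_nonneg h0 (by norm_num))]
    linarith
  have hpF : p = ∫ l, F l ∂w := by
    ext ⟨a, b, x, y⟩
    rw [eval_integral hint, hp, hu]
    simp only [F]
    rw [integral_mul_const]
    norm_num
  have hpV : p ∈ convexHull ℝ V := by
    rw [hpF]
    -- The hull of finitely many products is closed, so it contains the average over an arbitrary
    -- hidden variable.
    exact (convex_convexHull ℝ V).integral_mem ((Set.finite_range _).isClosed_convexHull ℝ)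
      (.of_forall hF) (Integrable.of_eval hint)
  refine convexHull_min ?_ (convex_convexHull ℝ _) hpV
  rintro _ ⟨v, rfl⟩
  exact productPoint_nsVertex_mem_localHull v.1 v.2

/-! ### Counting mismatches. -/

theorem ringBox_eq_zero_iff {R : Type} [CommRing R] [Fintype R] [DecidableEq R]
    (t : R × R × R × R) :
    ringBox (0 : R) 0 0 t = 0 ↔ ¬ t.1 + t.2.1 = t.2.2.1 * t.2.2.2 := by
  simp [ringBox]

theorem mismatch_ringBox {R : Type} [CommRing R] [Fintype R] [DecidableEq R] (f g : R → R) :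
    mismatch (ringBox 0 0 0) f g + (matchSet f g).card = Fintype.card R * Fintype.card R := by
  have h : {xy : R × R | ringBox (0 : R) 0 0 (f xy.1, g xy.2, xy.1, xy.2) = 0} =
      ((matchSet f g)ᶜ : Finset (R × R)) := by
    ext xy
    simp [ringBox_eq_zero_iff, matchSet]
  rw [mismatch, h, Set.ncard_coe_finset, ← Fintype.card_prod]
  exact Finset.card_compl_add_card _

theorem card_matchSet_two_le (f g : Fin 2 → Fin 2) : (matchSet f g).card ≤ 3 := by
  revert f g
  decide

/-- The words of length two, enumerated. -/
def binaryWord (i j : Fin 2) : Word 2 (Fin 2) := ![i, j]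

theorem sum_binaryWord (F : Word 2 (Fin 2) → ℕ) :
    ∑ x, F x = F (binaryWord 0 0) + F (binaryWord 0 1) + F (binaryWord 1 0) +
      F (binaryWord 1 1) := by
  rw [Fintype.sum_equiv (finTwoArrowEquiv (Fin 2)) F (fun t => F (binaryWord t.1 t.2)) fun x => by
    congr 1; ext i; fin_cases i <;> rfl]
  simp [Fintype.sum_prod_type, Fin.sum_univ_two, add_assoc]

theorem card_matchSet_word_le (f g : Word 2 (Fin 2) → Word 2 (Fin 2)) :
    (matchSet f g).card ≤ 10 := by
  let M (a b c d y : Word 2 (Fin 2)) (z : Word 2 (Fin 2)) : ℕ :=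
    (if a + z = binaryWord 0 0 * y then 1 else 0) + (if b + z = binaryWord 0 1 * y then 1 else 0) +
      (if c + z = binaryWord 1 0 * y then 1 else 0) + (if d + z = binaryWord 1 1 * y then 1 else 0)
  -- For a fixed `f`, given by eight bits, the best reply `g y` can be chosen separately for each
  -- `y`. This leaves 256 cases instead of all pairs of strategies.
  have key : ∀ i j i' j' k l k' l' : Fin 2, ∑ y : Fin 2 × Fin 2,
      (Finset.univ.sup fun z : Fin 2 × Fin 2 =>
        M (binaryWord i j) (binaryWord i' j') (binaryWord k l) (binaryWord k' l')
          (binaryWord y.1 y.2) (binaryWord z.1 z.2)) ≤ 10 := by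
    decide +kernel
  have hw : ∀ x : Word 2 (Fin 2), binaryWord (x 0) (x 1) = x := fun x => by
    ext i; fin_cases i <;> rfl
  have hM : (matchSet f g).card = ∑ y, M (f (binaryWord 0 0)) (f (binaryWord 0 1))
      (f (binaryWord 1 0)) (f (binaryWord 1 1)) y (g y) := by
    rw [matchSet, Finset.card_filter, Fintype.sum_prod_type_right]
    exact Finset.sum_congr rfl fun y _ => sum_binaryWord _
  rw [hM, sum_binaryWord]
  have h := key (f (binaryWord 0 0) 0) (f (binaryWord 0 0) 1) (f (binaryWord 0 1) 0)
    (f (binaryWord 0 1) 1) (f (binaryWord 1 0) 0) (f (binaryWord 1 0) 1)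
    (f (binaryWord 1 1) 0) (f (binaryWord 1 1) 1)
  refine le_trans ?_ h
  simp only [hw, Fintype.sum_prod_type, Fin.sum_univ_two, ← add_assoc]
  have hle : ∀ y : Word 2 (Fin 2), M (f (binaryWord 0 0)) (f (binaryWord 0 1))
      (f (binaryWord 1 0)) (f (binaryWord 1 1)) y (g y) ≤
      Finset.univ.sup fun z : Fin 2 × Fin 2 => M (f (binaryWord 0 0)) (f (binaryWord 0 1))
        (f (binaryWord 1 0)) (f (binaryWord 1 1)) y (binaryWord z.1 z.2) := by
    intro y
    refine le_trans (le_of_eq ?_) (Finset.le_sup (Finset.mem_univ (g y 0, g y 1)))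
    rw [hw]
  exact add_le_add (add_le_add (add_le_add (hle _) (hle _)) (hle _)) (hle _)

theorem one_le_mismatch_prBox (f g : Fin 2 → Fin 2) : 1 ≤ mismatch prBox f g := by
  have h := mismatch_ringBox f g
  have := card_matchSet_two_le f g
  rw [← prBox_eq_ringBox, Fintype.card_fin] at h
  omega

theorem six_le_mismatch_repetition_prBox (f g : Word 2 (Fin 2) → Word 2 (Fin 2)) :
    6 ≤ mismatch (repetition 2 prBox) f g := by
  have h := mismatch_ringBox f g
  have := card_matchSet_word_le f g
  rw [← repetition_prBox, Fintype.card_pi, Fin.prod_univ_two, Fintype.card_fin] at h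
  omega

/-! ### The PR box as extremal witness, and the resulting thresholds. -/

/-- The Popescu–Rohrlich box as a family of conditional distributions. -/
def prCond (x y : Fin 2) : Fin 2 × Fin 2 → ℝ :=
  fun ab => if ab.1 + ab.2 = x * y then 1 / 2 else 0

theorem isNoSignalling_prCond : IsNoSignalling prCond := by
  refine ⟨fun x y => ⟨fun ab => ?_, ?_⟩, fun a x y y' => ?_, fun b y x x' => ?_⟩
  · simp only [prCond]
    positivity
  · simp [prCond, Fintype.sum_prod_type, ← eq_sub_iff_add_eq']
  · simp [prCond, ← eq_sub_iff_add_eq']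
  · simp [prCond, ← eq_sub_iff_add_eq]

theorem inputDist_prBox (x y : Fin 2) : inputDist prBox x y = 1 / 4 := by
  simp only [inputDist, prBox, ← eq_sub_iff_add_eq']
  simp

theorem prBox_mem_probSpace : prBox ∈ probSpace (Fin 2) (Fin 2) (Fin 2) (Fin 2) := by
  rw [prBox_eq_ringBox]
  exact ⟨nsVertex_nonneg (.inr (0, 0, 0)), sum_nsVertex (.inr (0, 0, 0))⟩

theorem prBox_mem_nsSet_uniform : prBox ∈ nsSet (Fin 2) (Fin 2) (Fin 2) (Fin 2) ∩
    uniformSlice (Fin 2) (Fin 2) (Fin 2) (Fin 2) := by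
  refine ⟨⟨prBox_mem_probSpace, prCond, isNoSignalling_prCond, fun a b x y => ?_⟩,
    prBox_mem_probSpace, fun x y => ?_⟩
  · rw [inputDist_prBox]
    rfl
  · rw [inputDist_prBox]
    norm_num

theorem inputDist_repetition_prBox (x y : Word 2 (Fin 2)) :
    inputDist (repetition 2 prBox) x y = 1 / 16 := by
  rw [repetition_prBox]
  simp only [inputDist, ringBox, ← eq_sub_iff_add_eq']
  simp
  norm_num

theorem repetition_prBox_mem_nsProd_uniform :
    repetition 2 prBox ∈ nsProd (Fin 2) (Fin 2) (Fin 2) (Fin 2) 2 ∩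
      uniformSlice (Word 2 (Fin 2)) (Word 2 (Fin 2)) (Word 2 (Fin 2)) (Word 2 (Fin 2)) := by
  have h1 : repetition 2 prBox ∈
      probSpace (Word 2 (Fin 2)) (Word 2 (Fin 2)) (Word 2 (Fin 2)) (Word 2 (Fin 2)) :=
    productPoint_mem_probSpace fun _ => prBox_mem_probSpace
  refine ⟨⟨h1, Unit, inferInstance, Measure.dirac (), fun _ _ => prCond, inferInstance,
    fun _ _ _ _ => measurable_const, fun _ _ => isNoSignalling_prCond, fun a b x y => ?_⟩,
    h1, fun x y => ?_⟩
  · rw [inputDist_repetition_prBox, integral_dirac]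
    simp only [repetition, prBox, prCond, Fin.prod_univ_two]
    ring
  · rw [inputDist_repetition_prBox]
    simp
    norm_num

end Binary

theorem one_third_le_of_prBox_mem {h : ℝ}
    (hp : prBox ∈ mdlSet (Fin 2) (Fin 2) (Fin 2) (Fin 2) h) : 1 / 3 ≤ h := by
  have := one_le_of_mem_mdlSet hp one_le_mismatch_prBox
  norm_num at this
  linarith

theorem one_div_sqrt_ten_le_iff {h : ℝ} (h0 : 0 ≤ h) : 1 / √10 ≤ h ↔ 1 / 10 ≤ h ^ 2 := by
  rw [← Real.sqrt_le_left h0, Real.sqrt_div zero_le_one, Real.sqrt_one]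

theorem one_div_sqrt_ten_le_of_repetition_prBox_mem {h : ℝ} (h0 : 0 ≤ h)
    (hp : repetition 2 prBox ∈ mdlBlock (Fin 2) (Fin 2) (Fin 2) (Fin 2) 2 h) : 1 / √10 ≤ h := by
  have := one_le_of_mem_mdlSet hp six_le_mismatch_repetition_prBox
  rw [one_div_sqrt_ten_le_iff h0]
  norm_num at this
  linarith

end MDL

end

theorem mainTheorem1 :
    (∀ h : ℝ, 0 ≤ h →
      (MDL.nsProd (Fin 2) (Fin 2) (Fin 2) (Fin 2) 2 ∩
          MDL.uniformSlice (MDL.Word 2 (Fin 2)) (MDL.Word 2 (Fin 2))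
            (MDL.Word 2 (Fin 2)) (MDL.Word 2 (Fin 2)) ⊆
        MDL.mdlBlock (Fin 2) (Fin 2) (Fin 2) (Fin 2) 2 h ↔ 1 / √10 ≤ h)) ∧
    (∀ h : ℝ, 0 ≤ h →
      (MDL.repetition 2 MDL.prBox ∈ MDL.mdlBlock (Fin 2) (Fin 2) (Fin 2) (Fin 2) 2 h ↔
        1 / √10 ≤ h)) ∧
    (∀ f g : MDL.Word 2 (Fin 2) → MDL.Word 2 (Fin 2),
      6 ≤ MDL.mismatch (MDL.repetition 2 MDL.prBox) f g) ∧
    (∀ h : ℝ, 0 ≤ h →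
      (MDL.nsSet (Fin 2) (Fin 2) (Fin 2) (Fin 2) ∩
          MDL.uniformSlice (Fin 2) (Fin 2) (Fin 2) (Fin 2) ⊆
        MDL.mdlSet (Fin 2) (Fin 2) (Fin 2) (Fin 2) h ↔ 1 / 3 ≤ h)) ∧
    (∀ h : ℝ, 0 ≤ h → ∀ p ∈ MDL.mdlSet (Fin 2) (Fin 2) (Fin 2) (Fin 2) h,
      MDL.repetition 2 p ∈ MDL.mdlBlock (Fin 2) (Fin 2) (Fin 2) (Fin 2) 2 h) ∧
    (∀ h : ℝ, 1 / √10 ≤ h → h < 1 / 3 →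
      ∃ p ∈ MDL.nsSet (Fin 2) (Fin 2) (Fin 2) (Fin 2) ∩
          MDL.uniformSlice (Fin 2) (Fin 2) (Fin 2) (Fin 2),
        p ∉ MDL.mdlSet (Fin 2) (Fin 2) (Fin 2) (Fin 2) h ∧
        MDL.repetition 2 p ∈ MDL.mdlBlock (Fin 2) (Fin 2) (Fin 2) (Fin 2) 2 h) := by
  have hsub : ∀ h : ℝ, 1 / √10 ≤ h → MDL.nsProd (Fin 2) (Fin 2) (Fin 2) (Fin 2) 2 ∩
      MDL.uniformSlice (MDL.Word 2 (Fin 2)) (MDL.Word 2 (Fin 2))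
        (MDL.Word 2 (Fin 2)) (MDL.Word 2 (Fin 2)) ⊆
      MDL.mdlBlock (Fin 2) (Fin 2) (Fin 2) (Fin 2) 2 h := fun h hh p hp =>
    MDL.localHull_subset_mdlSet _ <| MDL.localHull_mono
      ((MDL.one_div_sqrt_ten_le_iff (le_trans (by positivity) hh)).1 hh)
      (MDL.nsProd_uniform_subset_localHull hp)
  have hPR := MDL.repetition_prBox_mem_nsProd_uniform
  refine ⟨fun h h0 => ⟨fun hs =>
      MDL.one_div_sqrt_ten_le_of_repetition_prBox_mem h0 (hs hPR), hsub h⟩,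
    fun h h0 => ⟨MDL.one_div_sqrt_ten_le_of_repetition_prBox_mem h0, fun hh => hsub h hh hPR⟩,
    MDL.six_le_mismatch_repetition_prBox,
    fun h _ => ⟨fun hs => MDL.one_third_le_of_prBox_mem (hs MDL.prBox_mem_nsSet_uniform),
      fun hh p hp => MDL.localHull_subset_mdlSet _ <| MDL.localHull_mono hh
        (MDL.nsSet_uniform_subset_localHull hp)⟩,
    fun h _ p hp => MDL.repetition_mem_mdlBlock hp 2,
    fun h hh h3 => ⟨MDL.prBox, MDL.prBox_mem_nsSet_uniform,
      fun hp => absurd (MDL.one_third_le_of_prBox_mem hp) h3.not_ge, hsub h hh hPR⟩⟩
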